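/- RESTART policy: a task needs an uninterrupted processing time $T>0$; the successive failure times $U_1,U_2,\ldots>0$ are i.i.d. and independent of $T$. If $U_1\le T$ the task is restarted from scratch, and so on, so that the total time until completion is $$X=T+\sum_{i=1}^{N}U_i,\qquad N=\inf\{n\ge 0:\ U_{n+1}>T\}.$$ Let $\overline H(x)=\mathbb P(X>x)$, and let $\mu=1/\mathbb E U_1$. Assume that $T$ has a density $f$ and that $U_1$ has a density $g$ on $(0,\infty)$ such that, as $t\to\infty$, $$f(t)\sim c_F\,e^{-\lambda_F t}\,t^{\alpha_F-1},\qquad g(t)\sim c_G\,e^{-\lambda_G t}\,t^{\alpha_G-1},$$ where $c_F,\lambda_F,c_G,\lambda_G>0$ and $\alpha_F,\alpha_G\in\mathbb R$. (In particular $0<\mathbb E U_1<\infty$.) Put $\alpha_H=\lambda_F/\lambda_G$. Then, as $x\to\infty$, $$\overline H(x)\ \sim\ c_H\,\frac{(\log x)^{(\alpha_F-1)-\alpha_H(\alpha_G-1)}}{x^{\alpha_H}},\qquad c_H=\frac{c_F\,\Gamma(\alpha_H)\,\lambda_G^{\,\alpha_H-1-(\alpha_F-1)+\alpha_H(\alpha_G-1)}}{\mu^{\alpha_H}\,c_G^{\alpha_H}}.$$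 -/

import Mathlib

open MeasureTheory ProbabilityTheory Filter Topology Asymptotics

/-- `X` is a positive random variable with density `f` on `(0, ∞)`. -/
structure HasPosDensity {Ω : Type*} [MeasurableSpace Ω] (P : Measure Ω) (X : Ω → ℝ)
    (f : ℝ → ℝ) : Prop where
  measurable : Measurable X
  density_measurable : Measurable f
  density_nonneg : ∀ t, 0 ≤ f t
  law : P.map X = (volume.restrict (Set.Ioi 0)).withDensity (fun t => ENNReal.ofReal (f t))

/-- `f` is asymptotically of the form `c e^{-l t} t^{a - 1}` as `t → ∞`, with `c, l > 0`. -/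
structure IsGammaLike (f : ℝ → ℝ) (l a c : ℝ) : Prop where
  rate_pos : 0 < l
  const_pos : 0 < c
  isEquivalent : f ~[atTop] fun t => c * Real.exp (-l * t) * t ^ (a - 1)

/-- Number of failures before completion of a task of length `t`. The entries `u 0, u 1, …` are
the successive failure times; attempt number `n` (counted from `0`) succeeds if `t < u n`.
(If no attempt ever succeeds, the value is `0`; this has probability zero when the failure times
are i.i.d. and unbounded.) -/
noncomputable def restartCount (t : ℝ) (u : ℕ → ℝ) : ℕ :=
  sInf {n : ℕ | t < u n}

/-- Total time under the RESTART policy: the failed attempts plus the final complete run. -/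
noncomputable def restartTotalTime (t : ℝ) (u : ℕ → ℝ) : ℝ :=
  t + ∑ i ∈ Finset.range (restartCount t u), u i

/-! Condition on T = t. The failed time S_t is a geometric sum of failure times truncated at t, and
conditioning on the first attempt gives the defective renewal equation z(y) = ∫_{u ≤ t} z(y - u)
ν(du) for y ≥ 0, with z = 1 on y < 0 (`failedTail_renewal`). Iterating it yields Lundberg bounds:
z(y) ≤ e^{-θy} if ∫_{u ≤ t} e^{θu} dν ≤ 1, and z(y) ≥ e^{-θ(y+t)} if that integral is ≥ 1
(`failedTail_le_exp`, `exp_le_failedTail`).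

Let p(t) = ν(t, ∞) and let m be the mean of ν. For small θ the truncated exponential moment is about
1 - p + θm, so the critical θ is about p/m. Since t p(t) → 0, the corrections of order θt vanish,
and P(X > x | T = t) tends to e^{-q/m} whenever t, x → ∞ and x p(t) → q (`tendsto_restartTail`). A
cruder bound 2 e^{-p(t)x/(4m)} holds for all t and x (`restartTail_le_exp`).

It remains to integrate these tails against f. Write l, k for the rates of f, g, put L = log x / k,
and let p(t) ~ C e^{-kt} t^b with C = c_G / k, b = α_G - 1. Take τ(x) with x e^{-kτ} L^b = 1; then τ
~ L. After t = τ + s, x p(t) → C e^{-ks} and f(t) / (e^{-lτ} L^{α_F - 1}) → c_F e^{-ls}. Dominated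
convergence leaves c_F ∫ e^{-ls} exp(-(C/m) e^{-ks}) ds, a Gamma integral under y = e^{-ks}
(`tendsto_mixture_div`). As s → -∞ the factor e^{-ls} grows, and the crude bound supplies the
domination. -/

/-- Prepending an independent copy of the common law to an i.i.d. sequence gives an i.i.d.
sequence. -/
theorem map_cons_prod_infinitePi (ν : Measure ℝ) [IsProbabilityMeasure ν] :
    (ν.prod (Measure.infinitePi fun _ : ℕ => ν)).map
      (fun p : ℝ × (ℕ → ℝ) => fun n => Nat.casesOn n p.1 p.2) =
    Measure.infinitePi fun _ : ℕ => ν := by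
  have hmeas : Measurable (fun p : ℝ × (ℕ → ℝ) => fun n => (Nat.casesOn n p.1 p.2 : ℝ)) := by
    refine measurable_pi_lambda _ fun n => ?_
    cases n with
    | zero => exact measurable_fst
    | succ n => exact (measurable_pi_apply n).comp measurable_snd
  refine Measure.eq_infinitePi _ fun s t ht => ?_
  classical
  obtain ⟨n, hn⟩ : ∃ n, s ⊆ Finset.range (n + 1) := by
    obtain ⟨n, hn⟩ := s.exists_nat_subset_range
    exact ⟨n, hn.trans (Finset.range_mono n.le_succ)⟩
  -- Padding with `Set.univ` turns `s` into an initial segment, from which coordinate 0 can be split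
  -- off.
  set t' : ℕ → Set ℝ := fun i => if i ∈ s then t i else Set.univ with ht'
  have ht'm : ∀ i, MeasurableSet (t' i) := by
    intro i
    by_cases hi : i ∈ s
    · simpa [ht', hi] using ht i
    · simp [ht', hi]
  have hpi : (s : Set ℕ).pi t = ((Finset.range (n + 1) : Finset ℕ) : Set ℕ).pi t' := by
    ext u
    simp only [Set.mem_pi, Finset.mem_coe, ht']
    constructor
    · intro h i _
      by_cases hi : i ∈ s
      · simpa [hi] using h i hi
      · simp [hi]
    · intro h i hi
      simpa [hi] using h i (hn hi)
  have hprod : ∏ i ∈ s, ν (t i) = ∏ i ∈ Finset.range (n + 1), ν (t' i) := by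
    rw [← Finset.prod_subset hn]
    · exact Finset.prod_congr rfl fun i hi => by simp [ht', hi]
    · intro i _ hi
      simp [ht', hi]
  rw [hprod, hpi, Measure.map_apply hmeas (.pi (Finset.countable_toSet _) fun i _ => ht'm i)]
  have hpre : (fun p : ℝ × (ℕ → ℝ) => fun n => (Nat.casesOn n p.1 p.2 : ℝ)) ⁻¹'
      ((Finset.range (n + 1) : Finset ℕ) : Set ℕ).pi t' =
      t' 0 ×ˢ ((Finset.range n : Finset ℕ) : Set ℕ).pi (fun i => t' (i + 1)) := by
    ext ⟨a, u⟩
    simp only [Set.mem_preimage, Set.mem_pi, Finset.mem_coe, Finset.mem_range, Set.mem_prod]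
    constructor
    · exact fun h => ⟨h 0 (by omega), fun i hi => h (i + 1) (by omega)⟩
    · rintro ⟨h0, h⟩ i hi
      cases i with
      | zero => exact h0
      | succ i => exact h i (by omega)
  rw [hpre, Measure.prod_prod, Measure.infinitePi_pi _ fun i _ => ht'm _,
    Finset.prod_range_succ', mul_comm]

/-! ### Failed time: effect of prepending an attempt, and measurability -/

/-- Total length of the failed attempts at a task of length `t`. -/
noncomputable def failedTime (t : ℝ) (u : ℕ → ℝ) : ℝ :=
  ∑ i ∈ Finset.range (restartCount t u), u i

theorem restartCount_cons_of_lt {t a : ℝ} (u : ℕ → ℝ) (h : t < a) :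
    restartCount t (fun n => Nat.casesOn n a u) = 0 :=
  Nat.sInf_eq_zero.2 (Or.inl h)

/-- The existence hypothesis excludes the default value: if no attempt succeeds, both counts are
`sInf ∅ = 0` and the recursion fails. -/
theorem restartCount_cons_of_le {t a : ℝ} {u : ℕ → ℝ} (h : a ≤ t) (hu : ∃ n, t < u n) :
    restartCount t (fun n => Nat.casesOn n a u) = restartCount t u + 1 := by
  have hS : {n : ℕ | t < (Nat.casesOn n a u : ℝ)}.Nonempty := hu.imp' (· + 1) fun _ h => h
  refine le_antisymm (Nat.sInf_le (Nat.sInf_mem (s := {n | t < u n}) hu)) ?_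
  have hmem := Nat.sInf_mem hS
  change restartCount t u + 1 ≤ sInf _
  cases hk : sInf {n : ℕ | t < (Nat.casesOn n a u : ℝ)} with
  | zero =>
    rw [hk] at hmem
    exact absurd hmem (not_lt.2 h)
  | succ k =>
    rw [hk] at hmem
    exact Nat.succ_le_succ (Nat.sInf_le hmem)

theorem failedTime_cons_of_lt {t a : ℝ} (u : ℕ → ℝ) (h : t < a) :
    failedTime t (fun n => Nat.casesOn n a u) = 0 := by
  rw [failedTime, restartCount_cons_of_lt u h, Finset.sum_range_zero]

theorem failedTime_cons_of_le {t a : ℝ} {u : ℕ → ℝ} (h : a ≤ t) (hu : ∃ n, t < u n) :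
    failedTime t (fun n => Nat.casesOn n a u) = a + failedTime t u := by
  rw [failedTime, restartCount_cons_of_le h hu, Finset.sum_range_succ', add_comm]
  rfl

theorem measurable_restartCount :
    Measurable fun p : ℝ × (ℕ → ℝ) => restartCount p.1 p.2 := by
  have hlt : ∀ i : ℕ, MeasurableSet {p : ℝ × (ℕ → ℝ) | p.1 < p.2 i} := fun i =>
    measurableSet_lt measurable_fst ((measurable_pi_apply i).comp measurable_snd)
  have hsucc : ∀ n : ℕ, MeasurableSet {p : ℝ × (ℕ → ℝ) | n < restartCount p.1 p.2} := by
    intro n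
    -- The union over all `i` is needed because a sequence without success has count 0, although all
    -- its attempts fail.
    have : {p : ℝ × (ℕ → ℝ) | n < restartCount p.1 p.2} =
        (⋃ i, {p : ℝ × (ℕ → ℝ) | p.1 < p.2 i}) ∩
          ⋂ i ∈ Finset.range (n + 1), {p : ℝ × (ℕ → ℝ) | p.1 < p.2 i}ᶜ := by
      ext p
      simp only [Set.mem_ofPred_eq, Set.mem_inter_iff, Set.mem_iUnion, Set.mem_iInter,
        Finset.mem_range, Set.mem_compl_iff]
      constructor
      · intro h
        refine ⟨?_, fun i hi hp => ?_⟩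
        · by_contra hne
          have : restartCount p.1 p.2 = 0 := Nat.sInf_eq_zero.2 <| Or.inr <|
            Set.eq_empty_of_forall_notMem fun i hi => hne ⟨i, hi⟩
          omega
        · have : restartCount p.1 p.2 ≤ i := Nat.sInf_le hp
          omega
      · rintro ⟨hex, hall⟩
        by_contra hle
        exact hall (restartCount p.1 p.2) (by omega) (Nat.sInf_mem (s := {n | p.1 < p.2 n}) hex)
    rw [this]
    exact (MeasurableSet.iUnion hlt).inter
      (Finset.measurableSet_biInter _ fun i _ => (hlt i).compl)
  exact measurable_of_Ioi fun n => hsucc n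

theorem measurable_failedTime : Measurable fun p : ℝ × (ℕ → ℝ) => failedTime p.1 p.2 := by
  have h : Measurable fun q : (ℝ × (ℕ → ℝ)) × ℕ => ∑ i ∈ Finset.range q.2, q.1.2 i := by
    refine measurable_from_prod_countable_left (fun n => ?_)
    change Measurable fun p : ℝ × (ℕ → ℝ) => ∑ i ∈ Finset.range n, p.2 i
    fun_prop
  exact h.comp (measurable_id.prodMk measurable_restartCount)

theorem measurable_restartTotalTime :
    Measurable fun p : ℝ × (ℕ → ℝ) => restartTotalTime p.1 p.2 :=
  measurable_fst.add measurable_failedTime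

/-! ### Renewal equation and Lundberg bounds -/

section Tail

variable (ν : Measure ℝ)

/-- Tail probability of the total length of the failed attempts, for i.i.d. failure times with
law `ν`. -/
noncomputable def failedTail (t y : ℝ) : ℝ :=
  (Measure.infinitePi fun _ : ℕ => ν).real {u | y < failedTime t u}

/-- Tail probability of the total time for a task of length `t`, for i.i.d. failure times with
law `ν`. -/
noncomputable def restartTail (t x : ℝ) : ℝ :=
  (Measure.infinitePi fun _ : ℕ => ν).real {u | x < restartTotalTime t u}

theorem restartTail_eq (t x : ℝ) : restartTail ν t x = failedTail ν t (x - t) := by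
  simp only [restartTail, failedTail, restartTotalTime, failedTime, sub_lt_iff_lt_add']

theorem failedTail_nonneg (t y : ℝ) : 0 ≤ failedTail ν t y := measureReal_nonneg

theorem restartTail_nonneg (t x : ℝ) : 0 ≤ restartTail ν t x := measureReal_nonneg

variable [IsProbabilityMeasure ν]

theorem failedTail_le_one (t y : ℝ) : failedTail ν t y ≤ 1 := measureReal_le_one

theorem restartTail_le_one (t x : ℝ) : restartTail ν t x ≤ 1 := measureReal_le_one

theorem antitone_failedTail (t : ℝ) : Antitone (failedTail ν t) := fun _ _ h =>
  measureReal_mono fun _ hu => lt_of_le_of_lt h hu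

theorem measurable_restartTail (x : ℝ) : Measurable fun t => restartTail ν t x := by
  have h : MeasurableSet {p : ℝ × (ℕ → ℝ) | x < restartTotalTime p.1 p.2} :=
    measurableSet_lt measurable_const measurable_restartTotalTime
  exact (measurable_measure_prodMk_left h).ennreal_toReal

variable {ν}

/-- The first `n` attempts all fail with probability `ν (Set.Iic t) ^ n`, which tends to 0. -/
theorem ae_exists_lt {t : ℝ} (ht : 0 < ν (Set.Ioi t)) :
    ∀ᵐ u ∂(Measure.infinitePi fun _ : ℕ => ν), ∃ n, t < u n := by
  have hlt : ν (Set.Iic t) < 1 := by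
    rw [← Set.compl_Ioi, prob_compl_eq_one_sub measurableSet_Ioi]
    exact ENNReal.sub_lt_self ENNReal.one_ne_top one_ne_zero ht.ne'
  rw [ae_iff, ← nonpos_iff_eq_zero]
  refine ge_of_tendsto' (ENNReal.tendsto_pow_atTop_nhds_zero_of_lt_one hlt) fun n => ?_
  calc (Measure.infinitePi fun _ : ℕ => ν) {u | ¬∃ n, t < u n}
      ≤ (Measure.infinitePi fun _ : ℕ => ν)
          (((Finset.range n : Finset ℕ) : Set ℕ).pi fun _ => Set.Iic t) := by
        refine measure_mono fun u hu i _ => ?_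
        simp only [Set.mem_ofPred_eq, not_exists, not_lt] at hu
        exact hu i
    _ = ν (Set.Iic t) ^ n := by
        rw [Measure.infinitePi_pi _ fun _ _ => measurableSet_Iic]
        simp

theorem failedTail_of_neg (hν : ∀ᵐ u ∂ν, 0 < u) (t : ℝ) {y : ℝ} (hy : y < 0) :
    failedTail ν t y = 1 := by
  have hall : ∀ᵐ u ∂(Measure.infinitePi fun _ : ℕ => ν), ∀ n, 0 < u n :=
    ae_all_iff.2 fun n =>
      (measurePreserving_eval_infinitePi (fun _ : ℕ => ν) n).quasiMeasurePreserving.ae hν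
  have : ∀ᵐ u ∂(Measure.infinitePi fun _ : ℕ => ν), u ∈ {u | y < failedTime t u} :=
    hall.mono fun u hu => hy.trans_le (Finset.sum_nonneg fun i _ => (hu i).le)
  have h1 : (Measure.infinitePi fun _ : ℕ => ν) {u | y < failedTime t u} = 1 := by
    rw [← measure_univ (μ := Measure.infinitePi fun _ : ℕ => ν)]
    exact measure_congr (eventuallyEq_univ.2 this)
  rw [failedTail, measureReal_def, h1, ENNReal.toReal_one]

/-- Condition on the first attempt `a`: if `a ≤ t` it adds `a` and the process starts afresh; if `a
> t` the failed time is 0, which does not exceed `y ≥ 0`. Hence only `Set.Iic t` contributes. -/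
theorem failedTail_renewal {t y : ℝ} (ht : 0 < ν (Set.Ioi t)) (hy : 0 ≤ y) :
    failedTail ν t y = ∫ u in Set.Iic t, failedTail ν t (y - u) ∂ν := by
  set κ := Measure.infinitePi fun _ : ℕ => ν with hκ
  have hmeas : Measurable (fun p : ℝ × (ℕ → ℝ) => fun n => (Nat.casesOn n p.1 p.2 : ℝ)) := by
    refine measurable_pi_lambda _ fun n => ?_
    cases n with
    | zero => exact measurable_fst
    | succ n => exact (measurable_pi_apply n).comp measurable_snd
  have hset : ∀ z, MeasurableSet {u : ℕ → ℝ | z < failedTime t u} := fun z =>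
    measurableSet_lt measurable_const
      (measurable_failedTime.comp (measurable_const.prodMk measurable_id))
  have hlin : κ {u | y < failedTime t u} =
      ∫⁻ a in Set.Iic t, κ {u | y - a < failedTime t u} ∂ν := by
    conv_lhs => rw [hκ, ← map_cons_prod_infinitePi ν]
    rw [Measure.map_apply hmeas (hset y), Measure.prod_apply (hmeas (hset y)),
      ← lintegral_indicator measurableSet_Iic]
    refine lintegral_congr fun a => ?_
    by_cases ha : a ≤ t
    · rw [Set.indicator_of_mem (show a ∈ Set.Iic t from ha)]
      refine measure_congr ?_
      filter_upwards [ae_exists_lt ht] with u hu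
      refine propext ?_
      change y < failedTime t (fun n => Nat.casesOn n a u) ↔ y - a < failedTime t u
      rw [failedTime_cons_of_le ha hu, sub_lt_iff_lt_add']
    · rw [Set.indicator_of_notMem (show a ∉ Set.Iic t from ha)]
      convert measure_empty (μ := κ)
      ext u
      simp only [Set.mem_preimage, Set.mem_ofPred_eq, Set.mem_empty_iff_false, iff_false]
      rw [failedTime_cons_of_lt u (not_le.1 ha)]
      exact not_lt.2 hy
  have hm : Measurable fun a => failedTail ν t (y - a) :=
    (antitone_failedTail ν t).measurable.comp (measurable_const.sub measurable_id)
  rw [integral_eq_lintegral_of_nonneg_ae (ae_of_all _ fun a => failedTail_nonneg ν t _)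
    hm.aestronglyMeasurable, failedTail, measureReal_def, ← hκ, hlin]
  congr 1
  refine lintegral_congr fun a => ?_
  rw [failedTail, ofReal_measureReal]

theorem integrableOn_failedTail (t y : ℝ) (s : Set ℝ) :
    IntegrableOn (fun u => failedTail ν t (y - u)) s ν := by
  refine Integrable.integrableOn (Integrable.of_bound (C := 1) ?_ (ae_of_all _ fun u => ?_))
  · exact ((antitone_failedTail ν t).measurable.comp
      (measurable_const.sub measurable_id)).aestronglyMeasurable
  · rw [Real.norm_of_nonneg (failedTail_nonneg ν t _)]
    exact failedTail_le_one ν t _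

theorem integrableOn_Iic_exp_mul {θ : ℝ} (hθ : 0 ≤ θ) (t : ℝ) :
    IntegrableOn (fun u => Real.exp (θ * u)) (Set.Iic t) ν := by
  refine Integrable.of_bound (C := Real.exp (θ * t))
    (by fun_prop) ?_
  refine (ae_restrict_mem measurableSet_Iic).mono fun u hu => ?_
  rw [Real.norm_of_nonneg (Real.exp_nonneg _)]
  exact Real.exp_le_exp.2 (mul_le_mul_of_nonneg_left hu hθ)

theorem measureReal_Iic_lt_one {t : ℝ} (ht : 0 < ν (Set.Ioi t)) : ν.real (Set.Iic t) < 1 := by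
  have : ν.real (Set.Iic t) = 1 - ν.real (Set.Ioi t) := by
    rw [← Set.compl_Ioi, probReal_compl_eq_one_sub measurableSet_Ioi]
  have h2 : 0 < ν.real (Set.Ioi t) := ENNReal.toReal_pos ht.ne' (measure_ne_top _ _)
  linarith

theorem nonpos_of_le_pow {a r : ℝ} (hr0 : 0 ≤ r) (hr : r < 1) (h : ∀ n : ℕ, a ≤ r ^ n) : a ≤ 0 :=
  ge_of_tendsto' (tendsto_pow_atTop_nhds_zero_of_lt_one hr0 hr) h

/-- Lundberg's upper bound for the failed attempts. -/
theorem failedTail_le_exp (hν : ∀ᵐ u ∂ν, 0 < u) {t θ : ℝ} (ht : 0 < ν (Set.Ioi t)) (hθ : 0 ≤ θ)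
    (h : ∫ u in Set.Iic t, Real.exp (θ * u) ∂ν ≤ 1) (y : ℝ) :
    failedTail ν t y ≤ Real.exp (-θ * y) := by
  -- Each renewal step multiplies the excess over the exponential by at most the defective mass
  -- `ν.real (Set.Iic t) < 1`, so the excess lies below every power. For `y < 0` the tail is 1 and
  -- the exponential is already at least 1.
  have key : ∀ n : ℕ, ∀ y, failedTail ν t y - Real.exp (-θ * y) ≤ ν.real (Set.Iic t) ^ n := by
    intro n
    induction n with
    | zero =>
      intro y
      rw [pow_zero]
      linarith [failedTail_le_one ν t y, Real.exp_pos (-θ * y)]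
    | succ n ih =>
      intro y
      rcases lt_or_ge y 0 with hy | hy
      · rw [failedTail_of_neg hν t hy]
        have : 1 ≤ Real.exp (-θ * y) := Real.one_le_exp (by nlinarith)
        have : 0 ≤ ν.real (Set.Iic t) ^ (n + 1) := by positivity
        linarith
      · have hint := (integrableOn_Iic_exp_mul (ν := ν) hθ t).const_mul (Real.exp (-θ * y))
        have h1 : failedTail ν t y ≤
            ∫ u in Set.Iic t, (Real.exp (-θ * y) * Real.exp (θ * u) +
              ν.real (Set.Iic t) ^ n) ∂ν := by
          rw [failedTail_renewal ht hy]
          refine integral_mono (integrableOn_failedTail t y _)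
            (hint.add (integrable_const _)) fun u => ?_
          have := ih (y - u)
          rw [← Real.exp_add]
          rw [show -θ * (y - u) = -θ * y + θ * u by ring] at this
          dsimp only
          linarith
        rw [integral_add hint (integrable_const _), integral_const_mul, setIntegral_const,
          smul_eq_mul] at h1
        have := mul_le_mul_of_nonneg_left h (Real.exp_nonneg (-θ * y))
        rw [pow_succ]
        linarith
  linarith [nonpos_of_le_pow measureReal_nonneg (measureReal_Iic_lt_one ht) fun n => key n y]

/-- Lundberg's lower bound for the failed attempts. -/
theorem exp_le_failedTail (hν : ∀ᵐ u ∂ν, 0 < u) {t θ : ℝ} (ht : 0 < ν (Set.Ioi t)) (hθ : 0 ≤ θ)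
    (h : 1 ≤ ∫ u in Set.Iic t, Real.exp (θ * u) ∂ν) {y : ℝ} (hy : -t ≤ y) :
    Real.exp (-θ * (y + t)) ≤ failedTail ν t y := by
  have key : ∀ n : ℕ, ∀ y, -t ≤ y →
      Real.exp (-θ * (y + t)) - failedTail ν t y ≤ ν.real (Set.Iic t) ^ n := by
    intro n
    induction n with
    | zero =>
      intro y hy
      rw [pow_zero]
      have : Real.exp (-θ * (y + t)) ≤ 1 := Real.exp_le_one_iff.2 (by nlinarith)
      linarith [failedTail_nonneg ν t y]
    | succ n ih =>
      intro y hyt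
      rcases lt_or_ge y 0 with hy | hy
      · rw [failedTail_of_neg hν t hy]
        have : Real.exp (-θ * (y + t)) ≤ 1 := Real.exp_le_one_iff.2 (by nlinarith)
        have : 0 ≤ ν.real (Set.Iic t) ^ (n + 1) := by positivity
        linarith
      · have hint := (integrableOn_Iic_exp_mul (ν := ν) hθ t).const_mul (Real.exp (-θ * (y + t)))
        have h1 : ∫ u in Set.Iic t, (Real.exp (-θ * (y + t)) * Real.exp (θ * u) -
              ν.real (Set.Iic t) ^ n) ∂ν ≤ failedTail ν t y := by
          rw [failedTail_renewal ht hy]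
          refine setIntegral_mono_on (hint.sub (integrable_const _))
            (integrableOn_failedTail t y _) measurableSet_Iic fun u hu => ?_
          have hu' : u ≤ t := hu
          -- The range is preserved: `y ≥ 0` and `u ≤ t` give `y - u ≥ -t`. The shift by `t` in the
          -- exponent keeps the exponential at most 1 on `[-t, 0)`, where the tail equals 1.
          have := ih (y - u) (by linarith)
          rw [← Real.exp_add]
          rw [show -θ * (y - u + t) = -θ * (y + t) + θ * u by ring] at this
          linarith
        rw [integral_sub hint (integrable_const _), integral_const_mul, setIntegral_const,
          smul_eq_mul] at h1
        have := mul_le_mul_of_nonneg_left h (Real.exp_nonneg (-θ * (y + t)))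
        rw [pow_succ]
        linarith
  linarith [nonpos_of_le_pow measureReal_nonneg (measureReal_Iic_lt_one ht) fun n => key n y hy]

end Tail

/-! ### Truncated exponential moments and the exponential limit law -/

section Bounds

variable {ν : Measure ℝ}

theorem tendsto_setIntegral_Iic_atTop (hint : Integrable (fun u => u) ν) :
    Tendsto (fun t => ∫ u in Set.Iic t, u ∂ν) atTop (𝓝 (∫ u, u ∂ν)) :=
  (aecover_Iic tendsto_id).integral_tendsto_of_countably_generated hint

variable [IsProbabilityMeasure ν]

theorem measureReal_Iic_eq (t : ℝ) : ν.real (Set.Iic t) = 1 - ν.real (Set.Ioi t) := by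
  rw [← Set.compl_Ioi, probReal_compl_eq_one_sub measurableSet_Ioi]

/-- From `e^{-θu} ≥ 1 - θu` one gets `e^{θu} ≤ 1 + θu e^{θu} ≤ 1 + θ e^{θt} u` for `0 < u ≤ t`;
integrate. -/
theorem setIntegral_exp_mul_le (hν : ∀ᵐ u ∂ν, 0 < u) (hint : Integrable (fun u => u) ν)
    {θ : ℝ} (hθ : 0 ≤ θ) (t : ℝ) :
    ∫ u in Set.Iic t, Real.exp (θ * u) ∂ν ≤
      1 - ν.real (Set.Ioi t) + θ * Real.exp (θ * t) * ∫ u, u ∂ν := by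
  have h1 : ∫ u in Set.Iic t, Real.exp (θ * u) ∂ν ≤
      ∫ u in Set.Iic t, (1 + θ * Real.exp (θ * t) * u) ∂ν := by
    refine integral_mono_ae (integrableOn_Iic_exp_mul hθ t)
      ((integrable_const _).add (hint.integrableOn.const_mul _)) ?_
    filter_upwards [ae_restrict_mem measurableSet_Iic, ae_restrict_of_ae hν] with u hu hu0
    have h2 := Real.add_one_le_exp (-(θ * u))
    have h3 : Real.exp (θ * u) * Real.exp (-(θ * u)) = 1 := by
      rw [← Real.exp_add, add_neg_cancel, Real.exp_zero]
    have h4 : Real.exp (θ * u) ≤ Real.exp (θ * t) :=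
      Real.exp_le_exp.2 (mul_le_mul_of_nonneg_left hu hθ)
    have h5 := mul_le_mul_of_nonneg_left h2 (Real.exp_nonneg (θ * u))
    have h6 := mul_le_mul_of_nonneg_left h4 (mul_nonneg hθ hu0.le)
    linarith
  rw [integral_add (integrable_const _) (hint.integrableOn.const_mul _), integral_const_mul,
    setIntegral_const, smul_eq_mul, mul_one, measureReal_Iic_eq] at h1
  have h2 : ∫ u in Set.Iic t, u ∂ν ≤ ∫ u, u ∂ν :=
    setIntegral_le_integral hint (hν.mono fun u hu => hu.le)
  have := mul_le_mul_of_nonneg_left h2 (mul_nonneg hθ (Real.exp_nonneg (θ * t)))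
  linarith

theorem le_setIntegral_exp_mul (hint : Integrable (fun u => u) ν)
    {θ : ℝ} (hθ : 0 ≤ θ) (t : ℝ) :
    1 - ν.real (Set.Ioi t) + θ * ∫ u in Set.Iic t, u ∂ν ≤
      ∫ u in Set.Iic t, Real.exp (θ * u) ∂ν := by
  have h1 : ∫ u in Set.Iic t, (1 + θ * u) ∂ν ≤ ∫ u in Set.Iic t, Real.exp (θ * u) ∂ν := by
    refine integral_mono ((integrable_const _).add (hint.integrableOn.const_mul _))
      (integrableOn_Iic_exp_mul hθ t) fun u => ?_
    have h2 := Real.add_one_le_exp (θ * u)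
    dsimp only
    linarith
  rwa [integral_add (integrable_const _) (hint.integrableOn.const_mul _), integral_const_mul,
    setIntegral_const, smul_eq_mul, mul_one, measureReal_Iic_eq] at h1

theorem mul_measureReal_Ioi_le_setIntegral (hint : Integrable (fun u => u) ν) (t : ℝ) :
    t * ν.real (Set.Ioi t) ≤ ∫ u in Set.Ioi t, u ∂ν := by
  have : ∫ u in Set.Ioi t, t ∂ν ≤ ∫ u in Set.Ioi t, u ∂ν :=
    setIntegral_mono_on (integrable_const _) hint.integrableOn measurableSet_Ioi fun u hu => hu.le
  rwa [setIntegral_const, smul_eq_mul, mul_comm] at this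

/-- Markov's inequality bounds the product by the tail of a convergent integral. This makes the task
length `t` negligible on the time scale `1 / ν(t, ∞)`. -/
theorem tendsto_mul_measureReal_Ioi (hint : Integrable (fun u => u) ν) :
    Tendsto (fun t => t * ν.real (Set.Ioi t)) atTop (𝓝 0) := by
  have h : Tendsto (fun t => ∫ u in Set.Ioi t, u ∂ν) atTop (𝓝 0) := by
    have := (tendsto_setIntegral_Iic_atTop hint).const_sub (∫ u, u ∂ν)
    rw [sub_self] at this
    refine this.congr fun t => ?_
    rw [← Set.compl_Iic, setIntegral_compl measurableSet_Iic hint]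
  refine tendsto_of_tendsto_of_tendsto_of_le_of_le' tendsto_const_nhds h ?_
    (Eventually.of_forall (mul_measureReal_Ioi_le_setIntegral hint))
  filter_upwards [eventually_ge_atTop 0] with t ht using mul_nonneg ht measureReal_nonneg

/-- An exponential bound on the tail of the total time that is uniform in the task length. -/
theorem restartTail_le_exp (hν : ∀ᵐ u ∂ν, 0 < u) (hint : Integrable (fun u => u) ν)
    (hm : 0 < ∫ u, u ∂ν) {t : ℝ} (htp : 0 < ν (Set.Ioi t)) (x : ℝ) :
    restartTail ν t x ≤ 2 * Real.exp (-(ν.real (Set.Ioi t) / (4 * ∫ u, u ∂ν) * x)) := by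
  set m := ∫ u, u ∂ν with hmdef
  set p := ν.real (Set.Ioi t) with hp
  have hp0 : 0 ≤ p := measureReal_nonneg
  have htpm : t * p ≤ m := (mul_measureReal_Ioi_le_setIntegral hint t).trans
    (setIntegral_le_integral hint (hν.mono fun u hu => hu.le))
  -- With `t p ≤ m` this gives `θt ≤ 1/4`, so `e^{θt} ≤ 4/3 ≤ 2` and the exponential moment is at
  -- most `1 - p + p/2`. The prefactor 2 in the result is the same bound on `e^{θt}`, which appears
  -- on passing from `x` to `x - t`.
  set θ := p / (4 * m) with hθdef
  have hθ : 0 ≤ θ := by positivity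
  have hθm : θ * m = p / 4 := by rw [hθdef]; field_simp
  have hθt : θ * t ≤ 1 / 4 := by
    rw [hθdef, div_mul_eq_mul_div, div_le_iff₀ (by positivity)]
    linarith
  have he : Real.exp (θ * t) ≤ 2 := by
    have h1 : Real.exp (θ * t) ≤ Real.exp (1 / 4) := Real.exp_le_exp.2 hθt
    have h2 := Real.exp_bound_div_one_sub_of_interval (x := 1 / 4) (by norm_num) (by norm_num)
    norm_num at h2
    linarith
  have hle : ∫ u in Set.Iic t, Real.exp (θ * u) ∂ν ≤ 1 := by
    refine (setIntegral_exp_mul_le hν hint hθ t).trans ?_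
    have : θ * Real.exp (θ * t) * m = p / 4 * Real.exp (θ * t) := by rw [← hθm]; ring
    rw [this]
    nlinarith
  rw [restartTail_eq]
  refine (failedTail_le_exp hν htp hθ hle (x - t)).trans ?_
  rw [show -θ * (x - t) = θ * t + -(θ * x) by ring, Real.exp_add]
  exact mul_le_mul_of_nonneg_right he (Real.exp_nonneg _)

/-- Exponential limit law for the total time of a long task. -/
theorem tendsto_restartTail (hν : ∀ᵐ u ∂ν, 0 < u) (hint : Integrable (fun u => u) ν)
    (hm : 0 < ∫ u, u ∂ν) (htp : ∀ t, 0 < ν (Set.Ioi t)) {ι : Type*} {l : Filter ι} {t x : ι → ℝ}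
    {q : ℝ} (ht : Tendsto t l atTop) (hx : Tendsto x l atTop)
    (hq : Tendsto (fun i => x i * ν.real (Set.Ioi (t i))) l (𝓝 q)) :
    Tendsto (fun i => restartTail ν (t i) (x i)) l (𝓝 (Real.exp (-(q / ∫ u, u ∂ν)))) := by
  set m := ∫ u, u ∂ν with hmdef
  have htp0 : Tendsto (fun i => t i * ν.real (Set.Ioi (t i))) l (𝓝 0) :=
    (tendsto_mul_measureReal_Ioi hint).comp ht
  have hcont : ∀ s : ℝ, Tendsto (fun δ : ℝ => Real.exp (-((1 + s * δ) / m * q))) (𝓝[>] 0)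
      (𝓝 (Real.exp (-(q / m)))) := by
    intro s
    have h : Continuous fun δ : ℝ => Real.exp (-((1 + s * δ) / m * q)) := by fun_prop
    have := h.tendsto 0
    rw [show Real.exp (-((1 + s * 0) / m * q)) = Real.exp (-(q / m)) by congr 1; ring] at this
    exact this.mono_left nhdsWithin_le_nhds
  refine tendsto_order.2 ⟨fun a ha => ?_, fun a ha => ?_⟩
  -- Lower bound with `θ = (1 + δ) p / m`: once the truncated mean exceeds `m / (1 + δ)`, the linear
  -- lower bound makes the exponential moment at least 1.
  · obtain ⟨δ, hδa, hδ0⟩ := (((hcont 1).eventually (lt_mem_nhds ha)).and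
      self_mem_nhdsWithin).exists
    have hδ0 : 0 < δ := hδ0
    rw [one_mul] at hδa
    have h1 : Tendsto (fun i => Real.exp (-((1 + δ) / m * (x i * ν.real (Set.Ioi (t i)))))) l
        (𝓝 (Real.exp (-((1 + δ) / m * q)))) :=
      (Real.continuous_exp.tendsto _).comp (hq.const_mul _).neg
    have h2 : ∀ᶠ i in l, m / (1 + δ) < ∫ u in Set.Iic (t i), u ∂ν :=
      ((tendsto_setIntegral_Iic_atTop hint).comp ht).eventually
        (lt_mem_nhds (div_lt_self hm (by linarith)))
    filter_upwards [h1.eventually (lt_mem_nhds hδa), h2,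
      hx.eventually_ge_atTop 0] with i hi1 hi2 hi3
    refine hi1.trans_le ?_
    set p := ν.real (Set.Ioi (t i)) with hp
    have hp0 : 0 ≤ p := measureReal_nonneg
    have hθ : 0 ≤ (1 + δ) / m * p := by positivity
    have hle : 1 ≤ ∫ u in Set.Iic (t i), Real.exp ((1 + δ) / m * p * u) ∂ν := by
      refine le_trans ?_ (le_setIntegral_exp_mul hint hθ (t i))
      have := mul_le_mul_of_nonneg_left hi2.le hθ
      rw [show (1 + δ) / m * p * (m / (1 + δ)) = p by field_simp] at this
      linarith
    rw [restartTail_eq]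
    -- At `y = x - t` the overshoot `t` in the Lundberg bound cancels the task length and leaves
    -- exactly `e^{-θx}`.
    refine le_of_eq_of_le ?_ (exp_le_failedTail hν (htp _) hθ hle (y := x i - t i) (by linarith))
    congr 1
    ring
  -- Upper bound with `θ = (1 - δ) p / m`: since `t p → 0`, the factor `e^{θt}` tends to 1, and the
  -- slack `1 - δ` keeps the exponential moment at most 1.
  · obtain ⟨δ, ⟨hδa, hδ0⟩, hδ1⟩ := ((((hcont (-1)).eventually (gt_mem_nhds ha)).and
      self_mem_nhdsWithin).and
      ((gt_mem_nhds (one_pos (α := ℝ))).filter_mono nhdsWithin_le_nhds)).exists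
    have hδ0 : 0 < δ := hδ0
    have hδ1 : δ < 1 := hδ1
    rw [neg_one_mul, ← sub_eq_add_neg] at hδa
    have h1 : Tendsto (fun i => Real.exp (-((1 - δ) / m *
        (x i * ν.real (Set.Ioi (t i)) - t i * ν.real (Set.Ioi (t i)))))) l
        (𝓝 (Real.exp (-((1 - δ) / m * q)))) := by
      have := ((hq.sub htp0).const_mul ((1 - δ) / m)).neg
      rw [sub_zero] at this
      exact (Real.continuous_exp.tendsto _).comp this
    have h2 : ∀ᶠ i in l, (1 - δ) * Real.exp ((1 - δ) / m * (t i * ν.real (Set.Ioi (t i)))) < 1 := by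
      have h3 := ((Real.continuous_exp.tendsto _).comp
        (htp0.const_mul ((1 - δ) / m))).const_mul (1 - δ)
      rw [mul_zero, Real.exp_zero, mul_one] at h3
      exact h3.eventually (gt_mem_nhds (by linarith))
    filter_upwards [h1.eventually (gt_mem_nhds hδa), h2] with i hi1 hi2
    refine lt_of_le_of_lt ?_ hi1
    set p := ν.real (Set.Ioi (t i)) with hp
    have hp0 : 0 ≤ p := measureReal_nonneg
    have hθ : 0 ≤ (1 - δ) / m * p := mul_nonneg (div_nonneg (by linarith) hm.le) hp0
    have hle : ∫ u in Set.Iic (t i), Real.exp ((1 - δ) / m * p * u) ∂ν ≤ 1 := by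
      refine (setIntegral_exp_mul_le hν hint hθ (t i)).trans ?_
      rw [← hmdef, ← hp, show (1 - δ) / m * p * t i = (1 - δ) / m * (t i * p) by ring,
        show (1 - δ) / m * p * Real.exp ((1 - δ) / m * (t i * p)) * m =
          p * ((1 - δ) * Real.exp ((1 - δ) / m * (t i * p))) by field_simp]
      nlinarith
    rw [restartTail_eq]
    refine (failedTail_le_exp hν (htp _) hθ hle (x i - t i)).trans_eq ?_
    congr 1
    ring

end Bounds

/-! ### From random variables to their laws -/

section Law

variable {Ω : Type*} [MeasurableSpace Ω] {P : Measure Ω} {X : Ω → ℝ} {f : ℝ → ℝ}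

theorem HasPosDensity.integral_map (hX : HasPosDensity P X f) (φ : ℝ → ℝ) :
    ∫ t, φ t ∂(P.map X) = ∫ t in Set.Ioi 0, f t * φ t := by
  rw [hX.law, integral_withDensity_eq_integral_toReal_smul
    hX.density_measurable.ennreal_ofReal (ae_of_all _ fun _ => ENNReal.ofReal_lt_top)]
  refine integral_congr_ae (ae_of_all _ fun t => ?_)
  simp only [ENNReal.toReal_ofReal (hX.density_nonneg t), smul_eq_mul]

theorem HasPosDensity.integrable_map_iff (hX : HasPosDensity P X f) (φ : ℝ → ℝ) :
    Integrable φ (P.map X) ↔ IntegrableOn (fun t => f t * φ t) (Set.Ioi 0) := by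
  rw [hX.law, integrable_withDensity_iff_integrable_smul'
    hX.density_measurable.ennreal_ofReal (ae_of_all _ fun _ => ENNReal.ofReal_lt_top)]
  refine integrable_congr (ae_of_all _ fun t => ?_)
  simp only [ENNReal.toReal_ofReal (hX.density_nonneg t), smul_eq_mul]

theorem HasPosDensity.ae_pos (hX : HasPosDensity P X f) : ∀ᵐ u ∂(P.map X), 0 < u := by
  rw [hX.law]
  exact (withDensity_absolutelyContinuous _ _).ae_le (ae_restrict_mem measurableSet_Ioi)

theorem HasPosDensity.isProbabilityMeasure_map [IsProbabilityMeasure P]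
    (hX : HasPosDensity P X f) : IsProbabilityMeasure (P.map X) :=
  Measure.isProbabilityMeasure_map hX.measurable.aemeasurable

theorem HasPosDensity.integrableOn [IsProbabilityMeasure P] (hX : HasPosDensity P X f) :
    IntegrableOn f (Set.Ioi 0) := by
  have := hX.isProbabilityMeasure_map
  simpa using (hX.integrable_map_iff fun _ => 1).1 (integrable_const _)

theorem HasPosDensity.measureReal_Ioi (hX : HasPosDensity P X f) {t : ℝ} (ht : 0 ≤ t) :
    (P.map X).real (Set.Ioi t) = ∫ s in Set.Ioi t, f s := by
  rw [← integral_indicator_one measurableSet_Ioi, hX.integral_map]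
  have : (fun s => f s * (Set.Ioi t).indicator 1 s) = (Set.Ioi t).indicator f := by
    ext s
    by_cases hs : s ∈ Set.Ioi t <;> simp [hs]
  rw [this, setIntegral_indicator measurableSet_Ioi, Set.Ioi_inter_Ioi, sup_eq_right.2 ht]

/-- Conditioning the completion time on the task length. -/
theorem measureReal_restartTotalTime_eq [IsProbabilityMeasure P] {T : Ω → ℝ} {U : ℕ → Ω → ℝ}
    {g : ℝ → ℝ} (hT : HasPosDensity P T f) (hU : ∀ n, HasPosDensity P (U n) g)
    (hindepU : iIndepFun U P) (hindepTU : IndepFun T (fun ω n => U n ω) P) (x : ℝ) :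
    P.real {ω | x < restartTotalTime (T ω) (fun n => U n ω)} =
      ∫ t in Set.Ioi 0, f t * restartTail (P.map (U 0)) t x := by
  have := hT.isProbabilityMeasure_map
  have := (hU 0).isProbabilityMeasure_map
  have hUm : Measurable fun ω n => U n ω := measurable_pi_lambda _ fun n => (hU n).measurable
  have hlaw : P.map (fun ω n => U n ω) = Measure.infinitePi fun _ : ℕ => P.map (U 0) := by
    rw [hindepU.map_fun_eq_infinitePi_map fun n => (hU n).measurable]
    congr 1
    ext1 n
    rw [(hU n).law, (hU 0).law]
  have hjoint := (indepFun_iff_map_prod_eq_prod_map_map hT.measurable.aemeasurable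
    hUm.aemeasurable).1 hindepTU
  rw [hlaw] at hjoint
  have hset : MeasurableSet {p : ℝ × (ℕ → ℝ) | x < restartTotalTime p.1 p.2} :=
    measurableSet_lt measurable_const measurable_restartTotalTime
  have hP : P {ω | x < restartTotalTime (T ω) (fun n => U n ω)} =
      P.map (fun ω => (T ω, fun n => U n ω)) {p | x < restartTotalTime p.1 p.2} :=
    (Measure.map_apply (hT.measurable.prodMk hUm) hset).symm
  rw [← hT.integral_map, measureReal_def, hP, hjoint, Measure.prod_apply hset,
    integral_eq_lintegral_of_nonneg_ae (ae_of_all _ fun t => restartTail_nonneg _ _ _)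
    (measurable_restartTail _ x).aestronglyMeasurable]
  congr 1
  refine lintegral_congr fun t => ?_
  rw [restartTail, ofReal_measureReal]
  rfl

end Law

/-! ### Functions of gamma type: dominating functions, shifts, tail integrals -/

section GammaLike

/-- The hypotheses place `w` in `[M⁻¹, M]`, and the sign of `b` decides which end is extremal. With
`M = 2 (1 + |s|)` this controls powers of shifted arguments whatever the sign of the exponent. -/
theorem rpow_le_rpow_abs_of_bounds {w M : ℝ} (hw : 0 < w) (h1 : w ≤ M) (h2 : 1 ≤ M * w)
    (b : ℝ) : w ^ b ≤ M ^ |b| := by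
  have hM : 0 < M := hw.trans_le h1
  rcases le_total 0 b with hb | hb
  · rw [abs_of_nonneg hb]
    exact Real.rpow_le_rpow hw.le h1 hb
  · rw [abs_of_nonpos hb]
    have h3 : M⁻¹ ≤ w := by
      rw [inv_le_iff_one_le_mul₀ hM]
      linarith
    have h4 := Real.rpow_le_rpow_of_nonpos (inv_pos.2 hM) h3 hb
    rwa [Real.inv_rpow hM.le, ← Real.rpow_neg hM.le] at h4

/-- Raise `z / n ≤ e^{z/n}` to the power `n`. With `z` a multiple of `e^{-ks}`, this trades
double-exponential decay for ordinary exponential decay in `s`. -/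
theorem exp_neg_le_mul_rpow_neg {n z : ℝ} (hn : 0 < n) (hz : 0 < z) :
    Real.exp (-z) ≤ n ^ n * z ^ (-n) := by
  have h1 : z / n ≤ Real.exp (z / n) := by linarith [Real.add_one_le_exp (z / n)]
  have h2 := Real.rpow_le_rpow (by positivity) h1 hn.le
  rw [← Real.exp_mul, div_mul_cancel₀ _ hn.ne', Real.div_rpow hz.le hn.le,
    div_le_iff₀ (by positivity)] at h2
  rw [Real.exp_neg, Real.rpow_neg hz.le, ← div_eq_mul_inv, inv_eq_one_div,
    div_le_div_iff₀ (Real.exp_pos _) (by positivity)]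
  linarith

theorem integrable_rpow_mul_exp_neg_mul_abs (M : ℝ) {l : ℝ} (hl : 0 < l) :
    Integrable fun s : ℝ => (2 * (1 + |s|)) ^ M * Real.exp (-l * |s|) := by
  have hcont : Continuous fun s : ℝ => (2 * (1 + |s|)) ^ M * Real.exp (-l * |s|) := by
    refine Continuous.mul (Continuous.rpow_const (by fun_prop) fun s => Or.inl ?_) (by fun_prop)
    positivity
  refine hcont.locallyIntegrable.integrable_of_isBigO_atTop_of_norm_isNegInvariant
    (g := fun s => Real.exp (-(l / 2) * s)) (Eventually.of_forall fun s => by simp) ?_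
    ⟨Set.Ioi 0, Ioi_mem_atTop 0, exp_neg_integrableOn_Ioi 0 (half_pos hl)⟩
  -- In `r = 2 (1 + s)`, the remaining factor `e^{-(l/2)s}` equals `e^{l/2} e^{-(l/4)r}`, hence the
  -- constants `l / 4` and `l / 2` below.
  have h1 : Tendsto (fun s : ℝ => 2 * (1 + s)) atTop atTop :=
    (tendsto_atTop_add_const_left _ _ tendsto_id).const_mul_atTop two_pos
  have h2 := ((tendsto_rpow_mul_exp_neg_mul_atTop_nhds_zero M (l / 4) (by positivity)).comp
    h1).mul_const (Real.exp (l / 2))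
  refine isBigO_of_div_tendsto_nhds (Eventually.of_forall fun s h => ?_) _ (h2.congr' ?_)
  · exact absurd h (Real.exp_pos _).ne'
  · filter_upwards [eventually_ge_atTop 0] with s hs
    rw [Pi.div_apply, abs_of_nonneg hs, Function.comp, mul_div_assoc, ← Real.exp_sub, mul_assoc,
      ← Real.exp_add]
    congr 2
    ring

theorem IsGammaLike.tendsto_div {f : ℝ → ℝ} {l a c : ℝ} (hf : IsGammaLike f l a c) :
    Tendsto (fun t => f t / (Real.exp (-l * t) * t ^ (a - 1))) atTop (𝓝 c) := by
  have h1 := (isEquivalent_iff_tendsto_one ?_).1 hf.isEquivalent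
  · have h2 := h1.const_mul c
    rw [mul_one] at h2
    refine h2.congr' ?_
    filter_upwards [eventually_gt_atTop 0] with t ht
    have := hf.const_pos
    have : 0 < t ^ (a - 1) := Real.rpow_pos_of_pos ht _
    rw [Pi.div_apply]
    field_simp
  · filter_upwards [eventually_gt_atTop 0] with t ht
    have := hf.const_pos
    have : 0 < t ^ (a - 1) := Real.rpow_pos_of_pos ht _
    positivity

theorem eventually_le_mul_of_tendsto_div {φ ψ : ℝ → ℝ} {C D : ℝ} (hψ : ∀ t, 0 < t → 0 < ψ t)
    (h : Tendsto (fun t => φ t / ψ t) atTop (𝓝 C)) (hD : C < D) :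
    ∀ᶠ t in atTop, φ t ≤ D * ψ t := by
  filter_upwards [h.eventually (gt_mem_nhds hD), eventually_gt_atTop 0] with t h1 h2
  exact (div_le_iff₀ (hψ t h2)).1 h1.le

theorem eventually_mul_le_of_tendsto_div {φ ψ : ℝ → ℝ} {C D : ℝ} (hψ : ∀ t, 0 < t → 0 < ψ t)
    (h : Tendsto (fun t => φ t / ψ t) atTop (𝓝 C)) (hD : D < C) :
    ∀ᶠ t in atTop, D * ψ t ≤ φ t := by
  filter_upwards [h.eventually (lt_mem_nhds hD), eventually_gt_atTop 0] with t h1 h2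
  exact (le_div_iff₀ (hψ t h2)).1 h1.le

theorem exp_mul_rpow_pos (l b : ℝ) {t : ℝ} (ht : 0 < t) : 0 < Real.exp (-l * t) * t ^ b :=
  mul_pos (Real.exp_pos _) (Real.rpow_pos_of_pos ht _)

/-- Asymptotics of a function of gamma type along a shifted argument. -/
theorem tendsto_shift_div {φ : ℝ → ℝ} {l b C : ℝ}
    (h : Tendsto (fun t => φ t / (Real.exp (-l * t) * t ^ b)) atTop (𝓝 C))
    {ι : Type*} {F : Filter ι} {τ L : ι → ℝ} (hτ : Tendsto τ F atTop)
    (hL : Tendsto L F atTop) (hτL : Tendsto (fun i => τ i / L i) F (𝓝 1)) (s : ℝ) :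
    Tendsto (fun i => φ (τ i + s) / (Real.exp (-l * τ i) * L i ^ b)) F
      (𝓝 (C * Real.exp (-l * s))) := by
  have ht : Tendsto (fun i => τ i + s) F atTop := tendsto_atTop_add_const_right _ _ hτ
  have hw : Tendsto (fun i => (τ i + s) / L i) F (𝓝 1) := by
    have := hτL.add (hL.const_div_atTop s)
    rw [add_zero] at this
    exact this.congr fun i => (add_div _ _ _).symm
  have hwb : Tendsto (fun i => ((τ i + s) / L i) ^ b) F (𝓝 1) := by
    have := hw.rpow_const (p := b) (Or.inl one_ne_zero)
    rwa [Real.one_rpow] at this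
  have := ((h.comp ht).mul hwb).mul_const (Real.exp (-l * s))
  rw [mul_one] at this
  refine this.congr' ?_
  filter_upwards [ht.eventually_gt_atTop 0, hL.eventually_gt_atTop 0] with i hi1 hi2
  have h1 : 0 < (τ i + s) ^ b := Real.rpow_pos_of_pos hi1 _
  have h2 : 0 < L i ^ b := Real.rpow_pos_of_pos hi2 _
  rw [Function.comp, Real.div_rpow hi1.le hi2.le, mul_add, Real.exp_add]
  field_simp

/-- The tail integral of a function of gamma type. -/
theorem IsGammaLike.tendsto_setIntegral_Ioi_div {g : ℝ → ℝ} {l a c : ℝ}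
    (hg : IsGammaLike g l a c) (hgm : Measurable g) (hg0 : ∀ t, 0 ≤ g t) :
    Tendsto (fun t => (∫ s in Set.Ioi t, g s) / (Real.exp (-l * t) * t ^ (a - 1))) atTop
      (𝓝 (c / l)) := by
  have hl := hg.rate_pos
  have hc := hg.const_pos
  have hlim : ∫ v in Set.Ioi (0 : ℝ), c * Real.exp (-l * v) = c / l := by
    rw [integral_const_mul, integral_exp_mul_Ioi (by linarith)]
    rw [mul_zero, Real.exp_zero]
    field_simp
  have hshift : ∀ t : ℝ, ∫ s in Set.Ioi t, g s = ∫ v in Set.Ioi (0 : ℝ), g (t + v) := by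
    intro t
    rw [← integral_indicator measurableSet_Ioi, ← integral_indicator measurableSet_Ioi,
      ← integral_add_left_eq_self _ t]
    refine integral_congr_ae (ae_of_all _ fun v => ?_)
    simp only [Set.indicator, Set.mem_Ioi, lt_add_iff_pos_right]
  obtain ⟨t₀, ht₀⟩ := eventually_atTop.1 ((eventually_le_mul_of_tendsto_div
    (fun t => exp_mul_rpow_pos l (a - 1)) hg.tendsto_div
    (lt_two_mul_self hc)).and (eventually_ge_atTop 1))
  have ht1 : 1 ≤ t₀ := (ht₀ t₀ le_rfl).2
  have key : Tendsto (fun t => ∫ v in Set.Ioi (0 : ℝ),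
      g (t + v) / (Real.exp (-l * t) * t ^ (a - 1))) atTop
      (𝓝 (∫ v in Set.Ioi (0 : ℝ), c * Real.exp (-l * v))) := by
    refine tendsto_integral_filter_of_dominated_convergence
      (fun v => 2 * c * ((2 * (1 + |v|)) ^ |a - 1| * Real.exp (-l * |v|)))
      (Eventually.of_forall fun t => ?_) ?_
      ((integrable_rpow_mul_exp_neg_mul_abs _ hl).const_mul _).integrableOn
      (ae_of_all _ fun v => ?_)
    · exact ((hgm.comp (measurable_const.add measurable_id)).div_const _).aestronglyMeasurable
    · filter_upwards [eventually_ge_atTop t₀] with t ht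
      refine (ae_restrict_mem measurableSet_Ioi).mono fun v hv => ?_
      have hv : 0 < v := hv
      have ht0 : 1 ≤ t := ht1.trans ht
      have htp : 0 < t := one_pos.trans_le ht0
      rw [Real.norm_of_nonneg (div_nonneg (hg0 _) (exp_mul_rpow_pos l _ htp).le),
        div_le_iff₀ (exp_mul_rpow_pos l _ htp), abs_of_pos hv]
      refine (ht₀ (t + v) (by linarith)).1.trans ?_
      have hw : ((t + v) / t) ^ (a - 1) ≤ (2 * (1 + v)) ^ |a - 1| := by
        refine rpow_le_rpow_abs_of_bounds (by positivity) ?_ ?_ _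
        · rw [div_le_iff₀ htp]
          nlinarith
        · rw [← mul_div_assoc, le_div_iff₀ htp]
          nlinarith
      rw [Real.div_rpow (by positivity) htp.le, div_le_iff₀ (Real.rpow_pos_of_pos htp _)] at hw
      rw [mul_add, Real.exp_add]
      have := mul_le_mul_of_nonneg_left hw
        (show 0 ≤ 2 * c * (Real.exp (-l * t) * Real.exp (-l * v)) by positivity)
      linarith
    · refine tendsto_shift_div hg.tendsto_div tendsto_id tendsto_id ?_ v
      refine tendsto_const_nhds.congr' ?_
      filter_upwards [eventually_gt_atTop 0] with t ht
      exact (div_self ht.ne').symm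
  rw [hlim] at key
  refine key.congr fun t => ?_
  rw [integral_div, hshift]

/-- Supplies the finite mean of the failure times: below a threshold `t₀` use `g t * t ≤ g t * t₀`,
above it the gamma-type bound. -/
theorem IsGammaLike.integrableOn_mul_id {g : ℝ → ℝ} {l a c : ℝ}
    (hg : IsGammaLike g l a c) (hgm : Measurable g) (hg0 : ∀ t, 0 ≤ g t)
    (hgi : IntegrableOn g (Set.Ioi 0)) : IntegrableOn (fun t => g t * t) (Set.Ioi 0) := by
  have hl := hg.rate_pos
  have hc := hg.const_pos
  obtain ⟨t₀, ht₀⟩ := eventually_atTop.1 ((eventually_le_mul_of_tendsto_div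
    (fun t => exp_mul_rpow_pos l (a - 1)) hg.tendsto_div
    (lt_two_mul_self hc)).and (eventually_ge_atTop 1))
  have ht1 : 1 ≤ t₀ := (ht₀ t₀ le_rfl).2
  have hb := ((integrable_rpow_mul_exp_neg_mul_abs |a| hl).const_mul (2 * c)).integrableOn
    (s := Set.Ioi 0)
  refine ((hgi.mul_const t₀).add hb).mono' (hgm.mul measurable_id).aestronglyMeasurable ?_
  refine (ae_restrict_mem measurableSet_Ioi).mono fun t ht => ?_
  have ht : 0 < t := ht
  have h1 : 0 ≤ g t * t₀ := mul_nonneg (hg0 t) (by linarith)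
  have h2 : 0 ≤ 2 * c * ((2 * (1 + |t|)) ^ |a| * Real.exp (-l * |t|)) := by positivity
  rw [Real.norm_of_nonneg (mul_nonneg (hg0 t) ht.le), Pi.add_apply]
  rcases le_total t t₀ with h | h
  · exact (mul_le_mul_of_nonneg_left h (hg0 t)).trans (le_add_of_nonneg_right h2)
  · refine le_trans ?_ (le_add_of_nonneg_left h1)
    have h3 := mul_le_mul_of_nonneg_right (ht₀ t h).1 ht.le
    have hw : t ^ a ≤ (2 * (1 + t)) ^ |a| :=
      rpow_le_rpow_abs_of_bounds ht (by linarith) (by nlinarith) _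
    have h4 : t ^ (a - 1) * t = t ^ a := by
      rw [← Real.rpow_add_one ht.ne', sub_add_cancel]
    rw [abs_of_pos ht]
    have h5 := mul_le_mul_of_nonneg_left hw (show 0 ≤ 2 * c * Real.exp (-l * t) by positivity)
    calc g t * t ≤ 2 * c * (Real.exp (-l * t) * t ^ (a - 1)) * t := h3
      _ = 2 * c * Real.exp (-l * t) * t ^ a := by rw [← h4]; ring
      _ ≤ _ := h5
      _ = _ := by ring

/-- The Gumbel-type integral evaluating to a Gamma function. -/
theorem integral_exp_neg_mul_mul_exp_neg_exp {l k q : ℝ} (hl : 0 < l) (hk : 0 < k) (hq : 0 < q) :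
    ∫ s : ℝ, Real.exp (-l * s) * Real.exp (-(q * Real.exp (-k * s))) =
      (1 / q) ^ (l / k) * Real.Gamma (l / k) / k := by
  -- Substitution `y = e^{-ks}`, mapping the line onto `(0, ∞)`.
  have himg : (fun s : ℝ => Real.exp (-k * s)) '' Set.univ = Set.Ioi 0 := by
    ext y
    simp only [Set.image_univ, Set.mem_range, Set.mem_Ioi]
    constructor
    · rintro ⟨s, rfl⟩
      exact Real.exp_pos _
    · intro hy
      refine ⟨-(Real.log y / k), ?_⟩
      rw [show -k * -(Real.log y / k) = Real.log y by field_simp, Real.exp_log hy]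
  have hinj : Set.InjOn (fun s : ℝ => Real.exp (-k * s)) Set.univ := by
    intro s _ t _ h
    have := Real.exp_injective h
    exact mul_left_cancel₀ (neg_ne_zero.2 hk.ne') this
  have hder : ∀ s ∈ (Set.univ : Set ℝ), HasDerivWithinAt (fun s : ℝ => Real.exp (-k * s))
      (Real.exp (-k * s) * (-k * 1)) Set.univ s := fun s _ =>
    (((hasDerivAt_id s).const_mul (-k)).exp).hasDerivWithinAt
  have h := integral_image_eq_integral_abs_deriv_smul MeasurableSet.univ hder hinj
    (fun y => y ^ (l / k - 1) * Real.exp (-(q * y)))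
  rw [himg, Real.integral_rpow_mul_exp_neg_mul_Ioi (div_pos hl hk) hq, setIntegral_univ] at h
  rw [h, eq_div_iff hk.ne', ← integral_mul_const]
  refine integral_congr_ae (ae_of_all _ fun s => ?_)
  have h1 : Real.exp (-k * s) * Real.exp (-k * s) ^ (l / k - 1) = Real.exp (-l * s) := by
    rw [← Real.exp_mul, ← Real.exp_add]
    congr 1
    field_simp
    ring
  have h2 : |Real.exp (-k * s) * (-k * 1)| = Real.exp (-k * s) * k := by
    rw [abs_mul, abs_of_pos (Real.exp_pos _), mul_one, abs_neg, abs_of_pos hk]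
  simp only [smul_eq_mul]
  rw [h2, ← h1]
  ring

end GammaLike

/-! ### Logarithmic scale and the Laplace-type asymptotic -/

section Laplace

/-- The solution `t` of `exp (-k t) * (log x / k) ^ b = 1 / x`. -/
noncomputable def logScale (k b x : ℝ) : ℝ :=
  Real.log x / k + b / k * Real.log (Real.log x / k)

theorem tendsto_log_div_atTop {k : ℝ} (hk : 0 < k) :
    Tendsto (fun x => Real.log x / k) atTop atTop :=
  Real.tendsto_log_atTop.atTop_div_const hk

/-- With `L = log x / k` the correction is a multiple of `log L`, which is `o(L)`. Hence `L` may
replace the centre `logScale k b x` inside powers, though not inside exponentials. -/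
theorem tendsto_logScale_div {k : ℝ} (hk : 0 < k) (b : ℝ) :
    Tendsto (fun x => logScale k b x / (Real.log x / k)) atTop (𝓝 1) := by
  have h1 : Tendsto (fun L : ℝ => Real.log L / L) atTop (𝓝 0) :=
    Real.isLittleO_log_id_atTop.tendsto_div_nhds_zero
  have h2 := ((h1.comp (tendsto_log_div_atTop hk)).const_mul (b / k)).const_add 1
  rw [mul_zero, add_zero] at h2
  refine h2.congr' ?_
  filter_upwards [(tendsto_log_div_atTop hk).eventually_gt_atTop 0] with x hx
  rw [logScale, add_div, div_self hx.ne', Function.comp, mul_div_assoc]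

theorem tendsto_logScale_atTop {k : ℝ} (hk : 0 < k) (b : ℝ) :
    Tendsto (logScale k b) atTop atTop := by
  refine ((tendsto_logScale_div hk b).pos_mul_atTop one_pos (tendsto_log_div_atTop hk)).congr' ?_
  filter_upwards [(tendsto_log_div_atTop hk).eventually_gt_atTop 0] with x hx
  exact div_mul_cancel₀ _ hx.ne'

theorem exp_neg_mul_logScale {k : ℝ} (hk : 0 < k) (b l : ℝ) {x : ℝ} (hx : 1 < x) :
    Real.exp (-l * logScale k b x) =
      x ^ (-(l / k)) * (Real.log x / k) ^ (-(l / k * b)) := by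
  have hL : 0 < Real.log x / k := div_pos (Real.log_pos hx) hk
  rw [Real.rpow_def_of_pos (by linarith), Real.rpow_def_of_pos hL, ← Real.exp_add, logScale]
  congr 1
  field_simp
  ring

theorem mul_exp_neg_mul_logScale {k : ℝ} (hk : 0 < k) (b : ℝ) {x : ℝ} (hx : 1 < x) :
    x * (Real.exp (-k * logScale k b x) * (Real.log x / k) ^ b) = 1 := by
  have hL : 0 < Real.log x / k := div_pos (Real.log_pos hx) hk
  rw [exp_neg_mul_logScale hk b k hx, div_self hk.ne', one_mul, mul_assoc, ← Real.rpow_add hL,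
    neg_add_cancel, Real.rpow_zero, mul_one, Real.rpow_neg_one, mul_inv_cancel₀ (by linarith)]

/-- The normalisation is a power of `x` times a power of `log x`, so exponentially small terms are
negligible against it. -/
theorem tendsto_exp_neg_mul_div_scale {k : ℝ} (hk : 0 < k) (l a b : ℝ) {δ : ℝ} (hδ : 0 < δ) :
    Tendsto (fun x => Real.exp (-δ * x) /
      (Real.exp (-l * logScale k b x) * (Real.log x / k) ^ a)) atTop (𝓝 0) := by
  have h1 := tendsto_rpow_mul_exp_neg_mul_atTop_nhds_zero (l / k + 1) δ hδ
  have h2 := (isLittleO_log_rpow_rpow_atTop (l / k * b - a) one_pos).tendsto_div_nhds_zero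
  have h3 := (h1.mul h2).mul_const (k ^ (-(l / k * b - a)))
  rw [mul_zero, zero_mul] at h3
  refine h3.congr' ?_
  filter_upwards [eventually_gt_atTop 1] with x hx
  have hx0 : 0 < x := by linarith
  have hlog := Real.log_pos hx
  have hL : 0 < Real.log x / k := div_pos hlog hk
  rw [exp_neg_mul_logScale hk b l hx, mul_assoc (x ^ _) _ ((Real.log x / k) ^ a),
    ← Real.rpow_add hL,
    show -(l / k * b) + a = -(l / k * b - a) by ring, Real.rpow_neg hL.le, Real.rpow_neg hx0.le,
    Real.div_rpow hlog.le hk.le, Real.rpow_neg hk.le, Real.rpow_add hx0, Real.rpow_one]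
  have := Real.rpow_pos_of_pos hx0 (l / k)
  have := Real.rpow_pos_of_pos hlog (l / k * b - a)
  have := Real.rpow_pos_of_pos hk (l / k * b - a)
  field_simp

/-- Pointwise domination of the rescaled integrand. -/
theorem rescaled_integrand_le {l k a b c C A B L τ x s fv Gv Fv : ℝ} (hl : 0 < l) (hk : 0 < k)
    (hc : 0 < c) (hC : 0 < C) (hA : 0 < A) (hB : 0 < B) (hL : 1 ≤ L) (hτ1 : L ≤ 2 * τ)
    (hτ2 : τ ≤ 2 * L) (ht : 1 ≤ τ + s) (hx : x * (Real.exp (-k * τ) * L ^ b) = 1) (hx0 : 0 < x)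
    (hf : fv ≤ c * (Real.exp (-l * (τ + s)) * (τ + s) ^ a))
    (hG : C * (Real.exp (-k * (τ + s)) * (τ + s) ^ b) ≤ Gv)
    (hF0 : 0 ≤ Fv) (hF1 : Fv ≤ 1) (hFA : Fv ≤ A * Real.exp (-(B * Gv * x))) :
    fv * Fv / (Real.exp (-l * τ) * L ^ a) ≤
      c * (1 + A * ((2 * l / k) ^ (2 * l / k) * (B * C) ^ (-(2 * l / k)))) *
        ((2 * (1 + |s|)) ^ (|a| + |b * -(2 * l / k)|) * Real.exp (-l * |s|)) := by
  -- Chosen so that `kn = 2l`: the bound on `Fv` then carries `e^{2ls}`, which turns `e^{-ls}` into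
  -- `e^{-l|s|}` for `s ≤ 0`. For `s ≥ 0` the bound `Fv ≤ 1` suffices.
  set n := 2 * l / k with hn
  set M := 2 * (1 + |s|) with hM
  set A' := A * (n ^ n * (B * C) ^ (-n)) with hA'
  have hn0 : 0 < n := by positivity
  have hkn : k * n = 2 * l := by rw [hn]; field_simp
  have hL0 : 0 < L := by linarith
  have ht0 : 0 < τ + s := by linarith
  have hBC : 0 < B * C := mul_pos hB hC
  have hA'0 : 0 < A' := by positivity
  have hs := abs_nonneg s
  have hM1 : 1 ≤ M := by rw [hM]; linarith
  set w := (τ + s) / L with hw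
  have hw0 : 0 < w := by positivity
  have hw1 : w ≤ M := by
    rw [hw, div_le_iff₀ hL0]
    nlinarith [le_abs_self s]
  -- Here `τ + s ≥ 1` is used: `M (τ + s) ≥ 2 (τ + s) + 2|s| ≥ 2τ ≥ L`.
  have hw2 : 1 ≤ M * w := by
    rw [hw, ← mul_div_assoc, le_div_iff₀ hL0]
    nlinarith [neg_abs_le s]
  have hta : (τ + s) ^ a = w ^ a * L ^ a := by
    rw [← Real.mul_rpow hw0.le hL0.le, hw, div_mul_cancel₀ _ hL0.ne']
  have htb : (τ + s) ^ b = w ^ b * L ^ b := by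
    rw [← Real.mul_rpow hw0.le hL0.le, hw, div_mul_cancel₀ _ hL0.ne']
  have hLa : 0 < L ^ a := Real.rpow_pos_of_pos hL0 _
  have hwb : 0 < w ^ b := Real.rpow_pos_of_pos hw0 _
  have hMb : 1 ≤ M ^ |b * -n| := Real.one_le_rpow hM1 (abs_nonneg _)
  have hfR : fv * Fv / (Real.exp (-l * τ) * L ^ a) ≤ c * Real.exp (-l * s) * M ^ |a| * Fv := by
    rw [div_le_iff₀ (by positivity)]
    refine (mul_le_mul_of_nonneg_right hf hF0).trans ?_
    rw [hta, mul_add, Real.exp_add]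
    have := mul_le_mul_of_nonneg_left (rpow_le_rpow_abs_of_bounds hw0 hw1 hw2 a)
      (show 0 ≤ c * Real.exp (-l * τ) * Real.exp (-l * s) * L ^ a * Fv by positivity)
    linarith
  have hGx : C * (Real.exp (-k * s) * w ^ b) ≤ Gv * x := by
    refine le_of_eq_of_le ?_ (mul_le_mul_of_nonneg_right hG hx0.le)
    rw [htb, mul_add, Real.exp_add]
    linear_combination (-C * Real.exp (-k * s) * w ^ b) * hx
  have hF2 : Fv ≤ A' * Real.exp (2 * l * s) * M ^ |b * -n| := by
    have hz : 0 < B * C * (Real.exp (-k * s) * w ^ b) := by positivity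
    have h1 : Real.exp (-(B * Gv * x)) ≤ Real.exp (-(B * C * (Real.exp (-k * s) * w ^ b))) := by
      refine Real.exp_le_exp.2 (neg_le_neg ?_)
      have := mul_le_mul_of_nonneg_left hGx hB.le
      linarith
    have h2 := exp_neg_le_mul_rpow_neg hn0 hz
    rw [Real.mul_rpow hBC.le (by positivity), Real.mul_rpow (Real.exp_nonneg _) hwb.le,
      ← Real.exp_mul, show -k * s * -n = 2 * l * s by rw [← hkn]; ring,
      ← Real.rpow_mul hw0.le] at h2
    have h3 := rpow_le_rpow_abs_of_bounds hw0 hw1 hw2 (b * -n)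
    have h4 := mul_le_mul_of_nonneg_left h3
      (show 0 ≤ A * (n ^ n * (B * C) ^ (-n)) * Real.exp (2 * l * s) by positivity)
    have h5 := mul_le_mul_of_nonneg_left (h1.trans h2) hA.le
    calc Fv ≤ _ := hFA.trans h5
      _ = A * (n ^ n * (B * C) ^ (-n)) * Real.exp (2 * l * s) * w ^ (b * -n) := by ring
      _ ≤ _ := h4
  have hexp : Real.exp (-l * s) * Fv ≤ (1 + A') * M ^ |b * -n| * Real.exp (-l * |s|) := by
    rcases le_total 0 s with h | h
    · rw [abs_of_nonneg h, mul_comm]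
      refine mul_le_mul_of_nonneg_right (hF1.trans ?_) (Real.exp_nonneg _)
      nlinarith
    · rw [abs_of_nonpos h]
      have h1 := mul_le_mul_of_nonneg_left hF2 (Real.exp_nonneg (-l * s))
      have h2 : Real.exp (-l * s) * Real.exp (2 * l * s) = Real.exp (-l * -s) := by
        rw [← Real.exp_add]
        congr 1
        ring
      have h3 : 0 ≤ M ^ |b * -n| * Real.exp (-l * -s) := by positivity
      calc Real.exp (-l * s) * Fv ≤ _ := h1
        _ = A' * (M ^ |b * -n| * Real.exp (-l * -s)) := by rw [← h2]; ring
        _ ≤ _ := by linarith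
  refine hfR.trans ?_
  rw [Real.rpow_add (by linarith)]
  have := mul_le_mul_of_nonneg_left hexp (show 0 ≤ c * M ^ |a| by positivity)
  linarith

/-- A Laplace-type asymptotic: the mixture of exponential-like tails with rate of gamma type
against a density of gamma type. -/
theorem tendsto_mixture_div {f : ℝ → ℝ} {l a c : ℝ} (hf : IsGammaLike f l a c)
    (hfm : Measurable f) (hf0 : ∀ t, 0 ≤ f t) (hfi : IntegrableOn f (Set.Ioi 0))
    {G : ℝ → ℝ} {k b C : ℝ} (hk : 0 < k) (hC : 0 < C) (hGanti : Antitone G) (hGpos : ∀ t, 0 < G t)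
    (hG : Tendsto (fun t => G t / (Real.exp (-k * t) * t ^ b)) atTop (𝓝 C))
    {F : ℝ → ℝ → ℝ} (hFm : ∀ x, Measurable fun t => F t x) (hF0 : ∀ t x, 0 ≤ F t x)
    (hF1 : ∀ t x, F t x ≤ 1) {A B m : ℝ} (hA : 0 < A) (hB : 0 < B) (hm : 0 < m)
    (hFA : ∀ t x, F t x ≤ A * Real.exp (-(B * G t * x)))
    (hFlim : ∀ (t : ℝ → ℝ) (q : ℝ), Tendsto t atTop atTop →
      Tendsto (fun x => x * G (t x)) atTop (𝓝 q) →
      Tendsto (fun x => F (t x) x) atTop (𝓝 (Real.exp (-(q / m))))) :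
    Tendsto (fun x => (∫ t in Set.Ioi 0, f t * F t x) /
      (Real.exp (-l * logScale k b x) * (Real.log x / k) ^ (a - 1))) atTop
      (𝓝 (c * ((m / C) ^ (l / k) * Real.Gamma (l / k) / k))) := by
  have hl := hf.rate_pos
  have hc := hf.const_pos
  obtain ⟨t₀, ht₀⟩ := eventually_atTop.1 (((eventually_le_mul_of_tendsto_div
    (fun t => exp_mul_rpow_pos l (a - 1)) hf.tendsto_div (lt_two_mul_self hc)).and
    (eventually_mul_le_of_tendsto_div (fun t => exp_mul_rpow_pos k b) hG (half_lt_self hC))).and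
    (eventually_ge_atTop 1))
  have ht1 : 1 ≤ t₀ := (ht₀ t₀ le_rfl).2
  set R : ℝ → ℝ := fun x => Real.exp (-l * logScale k b x) * (Real.log x / k) ^ (a - 1) with hR
  have hRpos : ∀ x, 1 < x → 0 < R x := fun x hx =>
    mul_pos (Real.exp_pos _) (Real.rpow_pos_of_pos (div_pos (Real.log_pos hx) hk) _)
  have hfF : ∀ x (s : Set ℝ), MeasurableSet s → s ⊆ Set.Ioi 0 →
      IntegrableOn (fun t => f t * F t x) s := by
    intro x s hs hsub
    refine (hfi.mono_set hsub).mono' (hfm.mul (hFm x)).aestronglyMeasurable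
      (ae_of_all _ fun t => ?_)
    rw [Real.norm_of_nonneg (mul_nonneg (hf0 t) (hF0 t x))]
    exact mul_le_of_le_one_right (hf0 t) (hF1 t x)
  have hsplit : ∀ x, ∫ t in Set.Ioi 0, f t * F t x =
      (∫ t in Set.Ioc 0 t₀, f t * F t x) + ∫ t in Set.Ioi t₀, f t * F t x := by
    intro x
    rw [← setIntegral_union Set.Ioc_disjoint_Ioi_same measurableSet_Ioi
      (hfF x _ measurableSet_Ioc fun t ht => ht.1)
      (hfF x _ measurableSet_Ioi (Set.Ioi_subset_Ioi (by linarith))),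
      Set.Ioc_union_Ioi_eq_Ioi (by linarith)]
  -- On `(0, t₀]` the rate `G` is at least `G t₀ > 0`, so this contribution is exponentially small
  -- in `x`.
  have hsmall : Tendsto (fun x => (∫ t in Set.Ioc 0 t₀, f t * F t x) / R x) atTop (𝓝 0) := by
    have h1 := (tendsto_exp_neg_mul_div_scale hk l (a - 1) b
      (mul_pos hB (hGpos t₀))).const_mul (A * ∫ t in Set.Ioi 0, f t)
    rw [mul_zero] at h1
    refine tendsto_of_tendsto_of_tendsto_of_le_of_le' tendsto_const_nhds h1 ?_ ?_
    · filter_upwards [eventually_gt_atTop 1] with x hx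
      exact div_nonneg (integral_nonneg fun t => mul_nonneg (hf0 t) (hF0 t x)) (hRpos x hx).le
    · filter_upwards [eventually_gt_atTop 1] with x hx
      rw [← mul_div_assoc]
      refine div_le_div_of_nonneg_right ?_ (hRpos x hx).le
      have h2 : ∫ t in Set.Ioc 0 t₀, f t * F t x ≤
          ∫ t in Set.Ioc 0 t₀, f t * (A * Real.exp (-(B * G t₀) * x)) := by
        refine setIntegral_mono_on (hfF x _ measurableSet_Ioc fun t ht => ht.1)
          ((hfi.mono_set fun t ht => ht.1).mul_const _) measurableSet_Ioc fun t ht => ?_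
        refine mul_le_mul_of_nonneg_left ((hFA t x).trans ?_) (hf0 t)
        refine mul_le_mul_of_nonneg_left (Real.exp_le_exp.2 ?_) hA.le
        have h3 := mul_le_mul_of_nonneg_left (hGanti ht.2) (mul_pos hB (one_pos.trans hx)).le
        linarith
      rw [integral_mul_const] at h2
      have h4 : ∫ t in Set.Ioc 0 t₀, f t ≤ ∫ t in Set.Ioi 0, f t :=
        setIntegral_mono_set hfi (ae_of_all _ hf0)
          (LE.le.eventuallyLE fun t ht => ht.1)
      have h5 := mul_le_mul_of_nonneg_right h4
        (show 0 ≤ A * Real.exp (-(B * G t₀) * x) by positivity)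
      linarith
  -- Recentre at `logScale k b x`; the indicator keeps the domain of integration equal to the whole
  -- line for every `x`.
  have hshift : ∀ x, (∫ t in Set.Ioi t₀, f t * F t x) / R x =
      ∫ s, (Set.Ioi t₀).indicator (fun t => f t * F t x / R x) (logScale k b x + s) := by
    intro x
    rw [integral_add_left_eq_self
      (fun s => (Set.Ioi t₀).indicator (fun t => f t * F t x / R x) s) (logScale k b x),
      integral_indicator measurableSet_Ioi, integral_div]
  have hlarge : Tendsto (fun x => (∫ t in Set.Ioi t₀, f t * F t x) / R x) atTop
      (𝓝 (∫ s : ℝ, c * (Real.exp (-l * s) * Real.exp (-(C / m * Real.exp (-k * s)))))) := by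
    simp_rw [hshift]
    refine tendsto_integral_filter_of_dominated_convergence
      (fun s => 2 * c * (1 + A * ((2 * l / k) ^ (2 * l / k) *
        (B * (C / 2)) ^ (-(2 * l / k)))) * ((2 * (1 + |s|)) ^ (|a - 1| + |b * -(2 * l / k)|) *
        Real.exp (-l * |s|))) (Eventually.of_forall fun x => ?_) ?_
      ((integrable_rpow_mul_exp_neg_mul_abs _ hl).const_mul _) (ae_of_all _ fun s => ?_)
    · exact ((((hfm.mul (hFm x)).div_const _).indicator measurableSet_Ioi).comp
        (measurable_const.add measurable_id)).aestronglyMeasurable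
    · have hlo := (tendsto_logScale_div hk b).eventually
        (lt_mem_nhds (show (1 / 2 : ℝ) < 1 by norm_num))
      have hhi := (tendsto_logScale_div hk b).eventually
        (gt_mem_nhds (show (1 : ℝ) < 2 by norm_num))
      filter_upwards [eventually_gt_atTop 1, hlo, hhi,
        (tendsto_log_div_atTop hk).eventually_ge_atTop 1] with x hx h1 h2 hL
      have hL0 : 0 < Real.log x / k := by linarith
      rw [lt_div_iff₀ hL0] at h1
      rw [div_lt_iff₀ hL0] at h2
      refine ae_of_all _ fun s => ?_
      by_cases hs : logScale k b x + s ∈ Set.Ioi t₀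
      · rw [Set.indicator_of_mem hs, Real.norm_of_nonneg
          (div_nonneg (mul_nonneg (hf0 _) (hF0 _ _)) (hRpos x hx).le)]
        have hs' : t₀ < logScale k b x + s := hs
        exact rescaled_integrand_le hl hk (by positivity) (half_pos hC) hA hB hL (by linarith)
          h2.le (ht1.trans hs'.le) (mul_exp_neg_mul_logScale hk b hx) (one_pos.trans hx)
          (ht₀ _ hs'.le).1.1 (ht₀ _ hs'.le).1.2 (hF0 _ _) (hF1 _ _) (hFA _ _)
      · rw [Set.indicator_of_notMem hs, norm_zero]
        positivity
    · have hτs : Tendsto (fun x => logScale k b x + s) atTop atTop :=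
        tendsto_atTop_add_const_right _ _ (tendsto_logScale_atTop hk b)
      have hfl := tendsto_shift_div hf.tendsto_div (tendsto_logScale_atTop hk b)
        (tendsto_log_div_atTop hk) (tendsto_logScale_div hk b) s
      have hGl := tendsto_shift_div hG (tendsto_logScale_atTop hk b)
        (tendsto_log_div_atTop hk) (tendsto_logScale_div hk b) s
      have hxG : Tendsto (fun x => x * G (logScale k b x + s)) atTop
          (𝓝 (C * Real.exp (-k * s))) := by
        refine hGl.congr' ?_
        filter_upwards [eventually_gt_atTop 1] with x hx
        have h1 := mul_exp_neg_mul_logScale hk b hx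
        rw [div_eq_iff (right_ne_zero_of_mul_eq_one h1)]
        linear_combination (-G (logScale k b x + s)) * h1
      have := hfl.mul (hFlim _ _ hτs hxG)
      rw [show C * Real.exp (-k * s) / m = C / m * Real.exp (-k * s) by ring, mul_assoc] at this
      refine this.congr' ?_
      filter_upwards [hτs.eventually_gt_atTop t₀] with x hx
      rw [Set.indicator_of_mem (show logScale k b x + s ∈ Set.Ioi t₀ from hx), div_mul_eq_mul_div]
  rw [integral_const_mul, integral_exp_neg_mul_mul_exp_neg_exp hl hk (div_pos hC hm),
    one_div_div] at hlarge
  have := hsmall.add hlarge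
  rw [zero_add] at this
  refine this.congr fun x => ?_
  rw [hsplit, add_div]

end Laplace

theorem mainTheorem9 {Ω : Type*} [MeasurableSpace Ω] (P : Measure Ω) [IsProbabilityMeasure P]
    (T : Ω → ℝ) (U : ℕ → Ω → ℝ) (f g : ℝ → ℝ)
    (hT : HasPosDensity P T f) (hU : ∀ n, HasPosDensity P (U n) g)
    (hindepU : iIndepFun U P) (hindepTU : IndepFun T (fun ω n => U n ω) P)
    (lF aF cF lG aG cG : ℝ)
    (hf : IsGammaLike f lF aF cF) (hg : IsGammaLike g lG aG cG)
    (μ aH cH : ℝ)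
    (hμ : μ = 1 / ∫ ω, U 0 ω ∂P)
    (haH : aH = lF / lG)
    (hcH : cH = cF * Real.Gamma aH * lG ^ (aH - 1 - (aF - 1) + aH * (aG - 1)) /
      (μ ^ aH * cG ^ aH)) :
    (fun x : ℝ => P.real {ω | x < restartTotalTime (T ω) (fun n => U n ω)}) ~[atTop]
      (fun x : ℝ => cH * Real.log x ^ ((aF - 1) - aH * (aG - 1)) / x ^ aH) := by
  have hlF := hf.rate_pos
  have hcF := hf.const_pos
  have hk := hg.rate_pos
  have hcG := hg.const_pos
  have hU0 := hU 0
  have := hU0.isProbabilityMeasure_map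
  set ν := P.map (U 0) with hνdef
  have hν : ∀ᵐ u ∂ν, 0 < u := hU0.ae_pos
  have hint : Integrable (fun u => u) ν := (hU0.integrable_map_iff _).2
    (hg.integrableOn_mul_id hU0.density_measurable hU0.density_nonneg hU0.integrableOn)
  have hmean : ∫ ω, U 0 ω ∂P = ∫ u, u ∂ν :=
    (integral_map hU0.measurable.aemeasurable hint.aestronglyMeasurable).symm
  have hm : 0 < ∫ u, u ∂ν := by
    refine (integral_pos_iff_support_of_nonneg_ae (hν.mono fun u hu => hu.le) hint).2 ?_
    have h1 : ν (Function.support fun u : ℝ => u) = ν Set.univ :=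
      measure_congr (eventuallyEq_univ.2 (hν.mono fun u hu => hu.ne'))
    rw [h1, measure_univ]
    exact one_pos
  set m := ∫ u, u ∂ν with hmdef
  have hGtail : Tendsto (fun t => ν.real (Set.Ioi t) / (Real.exp (-lG * t) * t ^ (aG - 1))) atTop
      (𝓝 (cG / lG)) := by
    refine (hg.tendsto_setIntegral_Ioi_div hU0.density_measurable hU0.density_nonneg).congr' ?_
    filter_upwards [eventually_ge_atTop 0] with t ht
    rw [hU0.measureReal_Ioi ht]
  have hGanti : Antitone fun t => ν.real (Set.Ioi t) := fun s t hst =>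
    measureReal_mono (Set.Ioi_subset_Ioi hst)
  have hGpos : ∀ t, 0 < ν.real (Set.Ioi t) := by
    intro t
    obtain ⟨s, ⟨h1, h2⟩, h3⟩ := ((eventually_mul_le_of_tendsto_div
      (fun t => exp_mul_rpow_pos lG (aG - 1)) hGtail (half_lt_self (div_pos hcG hk))).and
      (eventually_gt_atTop 0) |>.and (eventually_ge_atTop t)).exists
    refine lt_of_lt_of_le ?_ (hGanti h3)
    exact (mul_pos (half_pos (div_pos hcG hk)) (exp_mul_rpow_pos lG (aG - 1) h2)).trans_le h1
  have hGpos' : ∀ t, 0 < ν (Set.Ioi t) := fun t =>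
    pos_iff_ne_zero.2 fun h => (hGpos t).ne' (by rw [measureReal_def, h, ENNReal.toReal_zero])
  have hmain := tendsto_mixture_div hf hT.density_measurable hT.density_nonneg hT.integrableOn hk
    (div_pos hcG hk) hGanti hGpos hGtail (F := restartTail ν) (measurable_restartTail ν)
    (restartTail_nonneg ν) (restartTail_le_one ν) two_pos
    (show 0 < 1 / (4 * m) by positivity) hm
    (fun t x => (restartTail_le_exp hν hint hm (hGpos' t) x).trans_eq (by
      rw [div_mul_eq_mul_div (1 : ℝ), one_mul]))
    (fun t q ht hq => tendsto_restartTail hν hint hm hGpos' ht tendsto_id hq)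
  have hΓ : 0 < Real.Gamma (lF / lG) := Real.Gamma_pos_of_pos (div_pos hlF hk)
  -- The extra power of `lG` converts `log x / lG` in the normalisation into `log x`; the quotient
  -- `cG / lG` is the constant of the tail of `g`.
  have hK : cH * lG ^ ((aF - 1) - aH * (aG - 1)) =
      cF * ((m / (cG / lG)) ^ (lF / lG) * Real.Gamma (lF / lG) / lG) := by
    rw [hcH, hμ, hmean, ← haH, Real.div_rpow hm.le (div_pos hcG hk).le,
      Real.div_rpow hcG.le hk.le, Real.div_rpow one_pos.le hm.le, Real.one_rpow,
      show aH - 1 - (aF - 1) + aH * (aG - 1) = aH - (1 + ((aF - 1) - aH * (aG - 1))) by ring,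
      Real.rpow_sub hk, Real.rpow_add hk, Real.rpow_one]
    have := Real.rpow_pos_of_pos hk aH
    have := Real.rpow_pos_of_pos hk ((aF - 1) - aH * (aG - 1))
    have := Real.rpow_pos_of_pos hm aH
    have := Real.rpow_pos_of_pos hcG aH
    field_simp
  have hKpos : 0 < cF * ((m / (cG / lG)) ^ (lF / lG) * Real.Gamma (lF / lG) / lG) := by
    have := Real.rpow_pos_of_pos (div_pos hm (div_pos hcG hk)) (lF / lG)
    positivity
  refine isEquivalent_of_tendsto_one ?_
  have h1 := hmain.div_const (cF * ((m / (cG / lG)) ^ (lF / lG) * Real.Gamma (lF / lG) / lG))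
  rw [div_self hKpos.ne'] at h1
  refine h1.congr' ?_
  filter_upwards [eventually_gt_atTop 1] with x hx
  have hx0 : 0 < x := by linarith
  have hlog := Real.log_pos hx
  rw [Pi.div_apply, measureReal_restartTotalTime_eq hT hU hindepU hindepTU, ← hνdef, div_div,
    ← hK, exp_neg_mul_logScale hk _ _ hx, mul_assoc (x ^ _),
    ← Real.rpow_add (div_pos hlog hk), ← haH, Real.div_rpow hlog.le hk.le, Real.rpow_neg hx0.le,
    show -(aH * (aG - 1)) + (aF - 1) = (aF - 1) - aH * (aG - 1) by ring]
  have := Real.rpow_pos_of_pos hk ((aF - 1) - aH * (aG - 1))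
  congr 1
  field_simp
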